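/- Let $\lambda>1$, $m>0$, $K>0$ and $0\le\Delta\le 1$ be real numbers. Let $\mathcal G$ be an inverse gamma random variable with shape $\lambda$ and mean $1$. Let $\mathcal V$ be a fluctuating two-ray (FTR) random variable with mean $1$ and parameters $m,K,\Delta$. That is, $\mathcal V$ has the law of $|V|^2$, where $$V=\sqrt{\zeta}\,V_1e^{j\phi_1}+\sqrt{\zeta}\,V_2e^{j\phi_2}+X+jY .$$ Here $V_1,V_2\ge 0$ and $\sigma>0$ are constants with $K=\frac{V_1^2+V_2^2}{2\sigma^2}$ and $\Delta=\frac{2V_1V_2}{V_1^2+V_2^2}$. The random variables $\zeta,\phi_1,\phi_2,X,Y$ are independent, $\zeta$ is gamma distributed with shape $m$ and unit mean, $\phi_1,\phi_2$ are uniform on $[0,2\pi)$, and $X,Y\sim\mathcal N(0,\sigma^2)$. Assume that $\mathcal G$ and $\mathcal V$ are independent. Let $Z=\bar Z\,\mathcal G\,\mathcal V$ with $\bar Z=\mathbb E[Z]>0$ be the received power of the composite IG/FTR channel. For $\bar\gamma_z>0$ let $\gamma_z=\bar\gamma_z Z/\bar Z$ be the SNR with mean $\bar\gamma_z$. For $\gamma_{th}>0$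 let $P_{\rm out}(\gamma_{th})=P(\gamma_z<\gamma_{th})$ be the outage probability. Then, for every fixed $\gamma_{th}>0$, as $\bar\gamma_z\to\infty$, $$P_{\rm out}(\gamma_{th})\;\sim\;\frac{\Gamma(\lambda+1)}{\Gamma(\lambda)(\lambda-1)}\;\frac{1+K}{\left(1+\frac Km\right)^m}\;{}_2F_1\!\left(\frac m2,\frac{1+m}2;1;\frac{\Delta^2}{\left(\frac mK+1\right)^2}\right)\frac{\gamma_{th}}{\bar\gamma_z},$$ where ${}_2F_1$ is the Gauss hypergeometric function and $\sim$ means that the ratio of the two sides tends to $1$. -/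

import Mathlib

open MeasureTheory ProbabilityTheory Filter Asymptotics

/-- The uniform distribution on `[0, 2π)`. -/
noncomputable def uniformPhase : Measure ℝ :=
  ProbabilityTheory.cond volume (Set.Ico 0 (2 * Real.pi))

/-- The complex baseband signal
`√ζ V₁ exp(j φ₁) + √ζ V₂ exp(j φ₂) + X + j Y` of the fluctuating two-ray model. -/
noncomputable def ftrSignal (V₁ V₂ ζ φ₁ φ₂ X Y : ℝ) : ℂ :=
  (Real.sqrt ζ : ℂ) * (V₁ : ℂ) * Complex.exp (Complex.I * (φ₁ : ℂ))
    + (Real.sqrt ζ : ℂ) * (V₂ : ℂ) * Complex.exp (Complex.I * (φ₂ : ℂ))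
    + (X : ℂ) + Complex.I * (Y : ℂ)

/-- Law of the power `|V|²` of the fluctuating two-ray signal with specular amplitudes
`V₁`, `V₂`, diffuse standard deviation `σ` and fluctuation parameter `m`: the variables
`ζ ∼ Gamma(shape m, rate m)` (unit mean), `φ₁, φ₂ ∼ U[0, 2π)` and `X, Y ∼ N(0, σ²)`
are independent. -/
noncomputable def ftrPowerMeasure (V₁ V₂ σ m : ℝ) : Measure ℝ :=
  ((gammaMeasure m m).prod
    (uniformPhase.prod
      (uniformPhase.prod
        ((gaussianReal 0 (Real.toNNReal (σ ^ 2))).prod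
          (gaussianReal 0 (Real.toNNReal (σ ^ 2))))))).map
    (fun p : ℝ × ℝ × ℝ × ℝ × ℝ =>
      ‖ftrSignal V₁ V₂ p.1 p.2.1 p.2.2.1 p.2.2.2.1 p.2.2.2.2‖ ^ 2)

/-- `γ` follows the fluctuating two-ray distribution `FTR(γbar, m, K, Δ)`: it is distributed
as the power of a fluctuating two-ray signal whose amplitudes satisfy
`K = (V₁² + V₂²) / (2σ²)` and `Δ = 2 V₁ V₂ / (V₁² + V₂²)`, and its mean is `γbar`. -/
def IsFTR {Ω : Type*} [MeasurableSpace Ω] (P : Measure Ω) (γ : Ω → ℝ)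
    (γbar m K Δ : ℝ) : Prop :=
  (∃ V₁ V₂ σ : ℝ, 0 ≤ V₁ ∧ 0 ≤ V₂ ∧ 0 < σ ∧
      K = (V₁ ^ 2 + V₂ ^ 2) / (2 * σ ^ 2) ∧
      Δ = 2 * V₁ * V₂ / (V₁ ^ 2 + V₂ ^ 2) ∧
      HasLaw γ (ftrPowerMeasure V₁ V₂ σ m) P) ∧
    ∫ ω, γ ω ∂P = γbar

/-- The inverse gamma distribution with shape `lam` and scale `β`: the law of `1 / T` for
`T ∼ Gamma(shape lam, rate β)`. -/
noncomputable def inverseGammaMeasure (lam β : ℝ) : Measure ℝ :=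
  (gammaMeasure lam β).map (fun t : ℝ => t⁻¹)

/-- `G` is an inverse gamma variable with shape `lam` and mean `μ`. -/
def IsInverseGamma {Ω : Type*} [MeasurableSpace Ω] (P : Measure Ω) (G : Ω → ℝ)
    (lam μ : ℝ) : Prop :=
  (∃ β : ℝ, 0 < β ∧ HasLaw G (inverseGammaMeasure lam β) P) ∧ ∫ ω, G ω ∂P = μ

/-- Received power `Z = Zbar · G · V` of the composite channel with shadowing `G` and
fast fading `V`. -/
def compositePower {Ω : Type*} (Zbar : ℝ) (G V : Ω → ℝ) : Ω → ℝ :=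
  fun ω => Zbar * G ω * V ω

/-- Instantaneous SNR `γbar · Z / E[Z]` at average SNR `γbar`. -/
noncomputable def receivedSNR {Ω : Type*} [MeasurableSpace Ω] (P : Measure Ω)
    (Z : Ω → ℝ) (γbar : ℝ) : Ω → ℝ :=
  fun ω => γbar * Z ω / ∫ ω', Z ω' ∂P

/-- Outage probability `P(γ < γth)` of an SNR `γ` at the threshold `γth`. -/
noncomputable def outageProbability {Ω : Type*} [MeasurableSpace Ω] (P : Measure Ω)
    (γ : Ω → ℝ) (γth : ℝ) : ℝ :=
  P.real {ω | γ ω < γth}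

/-! Write the shadowing variable as `T⁻¹` with `T` gamma distributed. Since the composite mean is
`Zbar`, outage is the event `V < x * T` with `x = γth / γbar → 0`. If `P(V < v) ∼ d * v` at `0`,
conditioning on `T` gives `P(V < x * T) ∼ d * E[T] * x`; a linear bound on `P(V < v)` and the finite
mean of `T` justify dominated convergence (`tendsto_measureReal_prod_inv_mul_lt_div`). The unit mean
of `T⁻¹` forces `E[T] = lam / (lam - 1)`, which is the Gamma quotient. To find `d`, condition on the
specular part `w`: `V < v` says that the diffuse complex Gaussian falls in a disc of area `π v`
about `-w`, so `d` is `π` times its density at `-w`, averaged over `w`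
(`tendsto_measureReal_map_norm_add_sq_Iio_div`). That average is a Laplace transform of the specular
power: the gamma fluctuation gives a power `-m`, and the remaining phase average of `(1 + a cos x) ^
(-m)`, expanded by the binomial series, is the hypergeometric function
(`integral_one_add_mul_cos_rpow`). -/

/-! ### Cosine moments and the hypergeometric phase integral. -/

theorem integral_cos_pow_odd_zero_two_pi (k : ℕ) :
    ∫ x in (0 : ℝ)..2 * Real.pi, Real.cos x ^ (2 * k + 1) = 0 := by
  induction k with
  | zero => simp
  | succ k ih =>
    rw [show 2 * (k + 1) + 1 = (2 * k + 1) + 2 by ring, integral_cos_pow, ih]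
    simp

theorem integral_cos_pow_even_zero_two_pi (k : ℕ) :
    ∫ x in (0 : ℝ)..2 * Real.pi, Real.cos x ^ (2 * k)
      = 2 * Real.pi * ((2 * k).factorial / (4 ^ k * (k.factorial : ℝ) ^ 2)) := by
  induction k with
  | zero => simp
  | succ k ih =>
    rw [show 2 * (k + 1) = (2 * k) + 2 by ring, integral_cos_pow, ih]
    have h1 : ((2 * k + 2).factorial : ℝ) = (2 * k + 2) * (2 * k + 1) * (2 * k).factorial := by
      rw [Nat.factorial_succ, Nat.factorial_succ]; push_cast; ring
    have h2 : ((k + 1).factorial : ℝ) = (k + 1) * k.factorial := by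
      rw [Nat.factorial_succ]; push_cast; ring
    rw [h1, h2]
    have : (k.factorial : ℝ) ≠ 0 := by positivity
    simp only [Real.sin_two_pi, Real.sin_zero, mul_zero, sub_zero, zero_div, zero_add, pow_succ]
    push_cast
    field_simp
    ring

/-- Pair the factors: `m + 2j = 2 (m/2 + j)` and `m + 2j + 1 = 2 ((1+m)/2 + j)`. This is where the
two upper hypergeometric parameters come from. -/
theorem ascPochhammer_eval_two_mul (m : ℝ) (k : ℕ) :
    (ascPochhammer ℝ (2 * k)).eval m
      = 4 ^ k * (ascPochhammer ℝ k).eval (m / 2) * (ascPochhammer ℝ k).eval ((1 + m) / 2) := by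
  induction k with
  | zero => simp
  | succ k ih =>
    rw [show 2 * (k + 1) = (2 * k) + 1 + 1 by ring, ascPochhammer_succ_eval,
      ascPochhammer_succ_eval, ih, ascPochhammer_succ_eval, ascPochhammer_succ_eval]
    push_cast
    ring

theorem factorial_mul_choose_neg (m : ℝ) (n : ℕ) :
    (n.factorial : ℝ) * Ring.choose (-m) n = (-1) ^ n * (ascPochhammer ℝ n).eval m := by
  rw [← nsmul_eq_mul, ← Ring.descPochhammer_eq_factorial_smul_choose,
    Polynomial.descPochhammer_smeval_eq_ascPochhammer, Polynomial.ascPochhammer_smeval_eq_eval]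
  rw [← descPochhammer_eval_eq_ascPochhammer]
  have h := ascPochhammer_eval_neg_eq_descPochhammer ℝ (-m) n
  rw [neg_neg] at h
  rw [h, ← mul_assoc, ← mul_pow]
  simp

theorem hasSum_one_add_rpow {a x : ℝ} (hx : |x| < 1) :
    HasSum (fun n : ℕ => Ring.choose a n * x ^ n) ((1 + x) ^ a) := by
  have h := (Real.one_add_rpow_hasFPowerSeriesOnBall_zero (a := a)).hasSum (y := x)
    (by simpa [enorm_eq_nnnorm, ← NNReal.coe_lt_coe] using hx)
  simpa [-FormalMultilinearSeries.apply_eq_prod_smul_coeff] using h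

theorem summable_abs_choose_mul_pow {a x : ℝ} (hx : |x| < 1) :
    Summable (fun n : ℕ => |Ring.choose a n| * |x| ^ n) := by
  have h := (hasSum_one_add_rpow (a := a) hx).summable.abs
  simpa [abs_mul, abs_pow] using h

theorem hasSum_integral_one_add_mul_cos_rpow {a m : ℝ} (ha : |a| < 1) :
    HasSum (fun n : ℕ => ∫ x in (0 : ℝ)..2 * Real.pi,
      Ring.choose (-m) n * (a * Real.cos x) ^ n)
      (∫ x in (0 : ℝ)..2 * Real.pi, (1 + a * Real.cos x) ^ (-m)) := by
  refine intervalIntegral.hasSum_integral_of_dominated_convergence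
    (fun n _ => |Ring.choose (-m) n| * |a| ^ n) (fun n => ?_) (fun n => ?_) ?_ ?_ ?_
  · exact Continuous.aestronglyMeasurable (by fun_prop)
  · refine ae_of_all _ fun x _ => ?_
    rw [Real.norm_eq_abs, abs_mul, abs_pow, abs_mul]
    gcongr
    exact mul_le_of_le_one_right (abs_nonneg _) (Real.abs_cos_le_one x)
  · exact ae_of_all _ fun x _ => summable_abs_choose_mul_pow ha
  · exact intervalIntegrable_const
  · refine ae_of_all _ fun x _ => hasSum_one_add_rpow ?_
    rw [abs_mul]
    exact (mul_le_of_le_one_right (abs_nonneg _) (Real.abs_cos_le_one x)).trans_lt ha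

/-- Odd cosine moments vanish, so only the terms `n = 2k` of the binomial series survive; the
`(2k)!` of the even moment cancels the one in the binomial coefficient, and the powers of `4` cancel
too. -/
theorem integral_one_add_mul_cos_rpow {a m : ℝ} (ha : |a| < 1) :
    ∫ x in (0 : ℝ)..2 * Real.pi, (1 + a * Real.cos x) ^ (-m)
      = 2 * Real.pi * ordinaryHypergeometric (m / 2) ((1 + m) / 2) (1 : ℝ) (a ^ 2) := by
  have hs := hasSum_integral_one_add_mul_cos_rpow (m := m) ha
  simp only [mul_pow, intervalIntegral.integral_const_mul] at hs
  have hinj : Function.Injective (fun k : ℕ => 2 * k) := fun x y h => by simpa using h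
  rw [← hinj.hasSum_iff] at hs
  · rw [ordinaryHypergeometric_eq_tsum]
    rw [← tsum_mul_left, ← hs.tsum_eq]
    refine tsum_congr fun k => ?_
    rw [Function.comp_apply, integral_cos_pow_even_zero_two_pi]
    have h1 := factorial_mul_choose_neg m (2 * k)
    rw [ascPochhammer_eval_two_mul, pow_mul, neg_one_sq, one_pow, one_mul] at h1
    rw [ascPochhammer_eval_one, smul_eq_mul, pow_mul]
    have : (k.factorial : ℝ) ≠ 0 := by positivity
    calc _ = 2 * Real.pi * (a ^ 2) ^ k * (((2 * k).factorial : ℝ) * Ring.choose (-m) (2 * k))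
          / (4 ^ k * (k.factorial : ℝ) ^ 2) := by ring
      _ = _ := by rw [h1]; field_simp
  · intro n hn
    obtain ⟨k, rfl | rfl⟩ := Nat.even_or_odd' n
    · exact absurd ⟨k, rfl⟩ hn
    · rw [integral_cos_pow_odd_zero_two_pi, mul_zero, mul_zero]

/-! ### Moments and Laplace transform of the gamma law. -/

theorem ae_pos_gammaMeasure (a r : ℝ) : ∀ᵐ t ∂gammaMeasure a r, 0 < t := by
  have hm : Measurable (gammaPDF a r) := by unfold gammaPDF; fun_prop
  rw [gammaMeasure, ae_withDensity_iff hm]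
  -- The density need not vanish at `0`, so this null point is removed separately.
  have h0 : ∀ᵐ t : ℝ, t ≠ 0 := by simp [ae_iff]
  filter_upwards [h0] with t ht hpdf
  by_contra hneg
  exact hpdf (gammaPDF_of_neg (lt_of_le_of_ne (not_lt.1 hneg) ht))

theorem integral_gammaMeasure {a r : ℝ} (ha : 0 < a) (hr : 0 < r) (f : ℝ → ℝ) :
    ∫ t, f t ∂gammaMeasure a r
      = ∫ t in Set.Ioi 0, r ^ a / Real.Gamma a * t ^ (a - 1) * Real.exp (-(r * t)) * f t := by
  have hm : Measurable (gammaPDF a r) := by unfold gammaPDF; fun_prop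
  rw [gammaMeasure, integral_withDensity_eq_integral_toReal_smul hm (by simp [gammaPDF]),
    ← integral_Ici_eq_integral_Ioi, ← integral_indicator measurableSet_Ici]
  refine integral_congr_ae (ae_of_all _ fun t => ?_)
  by_cases ht : 0 ≤ t
  · have h := gammaPDFReal_nonneg ha hr t
    simp only [gammaPDF, ENNReal.toReal_ofReal h, smul_eq_mul]
    simp [Set.indicator, gammaPDFReal, ht]
  · simp [Set.indicator, ht, gammaPDF, gammaPDFReal]

theorem integral_id_gammaMeasure {a r : ℝ} (ha : 0 < a) (hr : 0 < r) :
    ∫ t, t ∂gammaMeasure a r = a / r := by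
  rw [integral_gammaMeasure ha hr]
  have h : ∀ t ∈ Set.Ioi (0 : ℝ), r ^ a / Real.Gamma a * t ^ (a - 1) * Real.exp (-(r * t)) * t
      = r ^ a / Real.Gamma a * (t ^ (a + 1 - 1) * Real.exp (-(r * t))) := by
    intro t ht
    rw [show a + 1 - 1 = (a - 1) + 1 by ring, Real.rpow_add_one (ne_of_gt ht)]
    ring
  rw [setIntegral_congr_fun measurableSet_Ioi h, integral_const_mul,
    Real.integral_rpow_mul_exp_neg_mul_Ioi (by linarith) hr, Real.Gamma_add_one ha.ne',
    one_div, Real.inv_rpow hr.le, Real.rpow_add_one hr.ne']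
  have := (Real.Gamma_pos_of_pos ha).ne'
  have := (Real.rpow_pos_of_pos hr a).ne'
  field_simp

theorem integrable_id_gammaMeasure {a r : ℝ} (ha : 0 < a) (hr : 0 < r) :
    Integrable (fun t => t) (gammaMeasure a r) :=
  -- A non-integrable function has Bochner integral `0`, so a nonzero value proves integrability.
  .of_integral_ne_zero (by rw [integral_id_gammaMeasure ha hr]; positivity)

theorem integral_exp_neg_gammaMeasure {a r s : ℝ} (ha : 0 < a) (hr : 0 < r) (hs : 0 ≤ s) :
    ∫ t, Real.exp (-(s * t)) ∂gammaMeasure a r = (1 + s / r) ^ (-a) := by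
  rw [integral_gammaMeasure ha hr]
  have h : ∀ t : ℝ, r ^ a / Real.Gamma a * t ^ (a - 1) * Real.exp (-(r * t)) * Real.exp (-(s * t))
      = r ^ a / Real.Gamma a * (t ^ (a - 1) * Real.exp (-((r + s) * t))) := by
    intro t
    rw [show -((r + s) * t) = -(r * t) + -(s * t) by ring, Real.exp_add]
    ring
  have hrs : 0 < r + s := by linarith
  simp only [h]
  rw [integral_const_mul, Real.integral_rpow_mul_exp_neg_mul_Ioi ha hrs,
    show 1 + s / r = (r + s) / r by field_simp, Real.rpow_neg (by positivity),
    Real.div_rpow hrs.le hr.le, Real.div_rpow zero_le_one hrs.le, Real.one_rpow]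
  have := (Real.Gamma_pos_of_pos ha).ne'
  have := (Real.rpow_pos_of_pos hrs a).ne'
  field_simp

/-! ### Uniform phases. -/

instance isProbabilityMeasure_uniformPhase : IsProbabilityMeasure uniformPhase :=
  ProbabilityTheory.cond_isProbabilityMeasure_of_finite
    (by simp [Real.pi_pos]) (by simp [ENNReal.mul_eq_top])

theorem integral_uniformPhase (f : ℝ → ℝ) :
    ∫ x, f x ∂uniformPhase = (2 * Real.pi)⁻¹ * ∫ x in (0 : ℝ)..2 * Real.pi, f x := by
  rw [uniformPhase, ProbabilityTheory.cond, integral_smul_measure,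
    intervalIntegral.integral_of_le Real.two_pi_pos.le, ← integral_Ico_eq_integral_Ioc]
  simp [ENNReal.toReal_ofReal, Real.pi_pos.le]

/-- For each fixed second phase, the shift is absorbed by integrating over a full period; the phase
difference therefore acts as a single uniform phase. -/
theorem integral_comp_sub_uniformPhase_prod {k : ℝ → ℝ} (hk : Continuous k)
    (hper : Function.Periodic k (2 * Real.pi)) :
    ∫ p, k (p.1 - p.2) ∂(uniformPhase.prod uniformPhase) = ∫ x, k x ∂uniformPhase := by
  obtain ⟨C, hC⟩ := (hper.isBounded_of_continuous Real.two_pi_pos.ne' hk).exists_norm_le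
  have hint : Integrable (fun p : ℝ × ℝ => k (p.1 - p.2)) (uniformPhase.prod uniformPhase) :=
    .of_bound (Continuous.aestronglyMeasurable (by fun_prop)) C
      (ae_of_all _ fun p => hC _ ⟨_, rfl⟩)
  rw [integral_prod_symm _ hint]
  have h : ∀ y, ∫ x, k (x - y) ∂uniformPhase = ∫ x, k x ∂uniformPhase := by
    intro y
    rw [integral_uniformPhase, integral_uniformPhase,
      intervalIntegral.integral_comp_sub_right (fun x => k x) y]
    have := hper.intervalIntegral_add_eq (0 - y) 0
    rw [zero_add] at this
    rw [← this]
    congr 2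
    ring
  simp [h]

/-! ### The specular component: power and Laplace transform. -/

/-- The specular component of the fluctuating two-ray signal. -/
noncomputable def specularSignal (V₁ V₂ : ℝ) (p : ℝ × ℝ × ℝ) : ℂ :=
  (Real.sqrt p.1 : ℂ) * (V₁ : ℂ) * Complex.exp (Complex.I * (p.2.1 : ℂ))
    + (Real.sqrt p.1 : ℂ) * (V₂ : ℂ) * Complex.exp (Complex.I * (p.2.2 : ℂ))

theorem continuous_specularSignal (V₁ V₂ : ℝ) : Continuous (specularSignal V₁ V₂) := by
  unfold specularSignal
  fun_prop

theorem norm_specularSignal_sq (V₁ V₂ : ℝ) {p : ℝ × ℝ × ℝ} (hp : 0 ≤ p.1) :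
    ‖specularSignal V₁ V₂ p‖ ^ 2
      = p.1 * (V₁ ^ 2 + V₂ ^ 2 + 2 * V₁ * V₂ * Real.cos (p.2.1 - p.2.2)) := by
  obtain ⟨t, x, y⟩ := p
  have hs := Real.sq_sqrt hp
  rw [← Complex.normSq_eq_norm_sq, Complex.normSq_apply]
  simp only [specularSignal, mul_comm Complex.I, Complex.exp_mul_I, ← Complex.ofReal_cos,
    ← Complex.ofReal_sin, Complex.add_re, Complex.add_im, Complex.mul_re, Complex.mul_im,
    Complex.ofReal_re, Complex.ofReal_im, Complex.I_re, Complex.I_im]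
  rw [Real.cos_sub]
  simp only at hs
  have h1 := Real.sin_sq_add_cos_sq x
  have h2 := Real.sin_sq_add_cos_sq y
  simp only [mul_zero, zero_mul, mul_one, sub_zero, add_zero, zero_add]
  linear_combination (V₁ ^ 2 * (Real.sin x ^ 2 + Real.cos x ^ 2)
    + V₂ ^ 2 * (Real.sin y ^ 2 + Real.cos y ^ 2)
    + 2 * V₁ * V₂ * (Real.cos x * Real.cos y + Real.sin x * Real.sin y)) * hs
    + t * V₁ ^ 2 * h1 + t * V₂ ^ 2 * h2

/-- The law of the specular component of the fluctuating two-ray signal. -/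
noncomputable def specularLaw (V₁ V₂ m : ℝ) : Measure ℂ :=
  ((gammaMeasure m m).prod (uniformPhase.prod uniformPhase)).map (specularSignal V₁ V₂)

theorem isProbabilityMeasure_specularLaw (V₁ V₂ : ℝ) {m : ℝ} (hm : 0 < m) :
    IsProbabilityMeasure (specularLaw V₁ V₂ m) := by
  have := isProbabilityMeasure_gammaMeasure hm hm
  exact Measure.isProbabilityMeasure_map (continuous_specularSignal V₁ V₂).aemeasurable

theorem ae_nonneg_fst_gamma_prod {m : ℝ} (hm : 0 < m) :
    ∀ᵐ p ∂((gammaMeasure m m).prod (uniformPhase.prod uniformPhase)), 0 ≤ p.1 := by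
  have := isProbabilityMeasure_gammaMeasure hm hm
  exact (Measure.quasiMeasurePreserving_fst.ae (ae_pos_gammaMeasure m m)).mono fun _ h => h.le

theorem integrable_cos_uniformPhase (A B : ℝ) :
    Integrable (fun q : ℝ × ℝ => A + B * Real.cos (q.1 - q.2))
      (uniformPhase.prod uniformPhase) := by
  refine .of_bound (Continuous.aestronglyMeasurable (by fun_prop)) (|A| + |B|)
    (ae_of_all _ fun p => (abs_add_le _ _).trans ?_)
  rw [abs_mul]
  gcongr
  exact mul_le_of_le_one_right (abs_nonneg _) (Real.abs_cos_le_one _)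

theorem integrable_norm_sq_specularLaw (V₁ V₂ : ℝ) {m : ℝ} (hm : 0 < m) :
    Integrable (fun w => ‖w‖ ^ 2) (specularLaw V₁ V₂ m) := by
  have := isProbabilityMeasure_gammaMeasure hm hm
  rw [specularLaw, integrable_map_measure (Continuous.aestronglyMeasurable (by fun_prop))
    (continuous_specularSignal V₁ V₂).aemeasurable]
  refine ((integrable_id_gammaMeasure hm hm).mul_prod
    (integrable_cos_uniformPhase (V₁ ^ 2 + V₂ ^ 2) (2 * V₁ * V₂))).congr ?_
  filter_upwards [ae_nonneg_fst_gamma_prod hm] with p hp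
  exact (norm_specularSignal_sq V₁ V₂ hp).symm

theorem integral_norm_sq_specularLaw (V₁ V₂ : ℝ) {m : ℝ} (hm : 0 < m) :
    ∫ w, ‖w‖ ^ 2 ∂specularLaw V₁ V₂ m = V₁ ^ 2 + V₂ ^ 2 := by
  have := isProbabilityMeasure_gammaMeasure hm hm
  rw [specularLaw, integral_map (continuous_specularSignal V₁ V₂).aemeasurable
    (Continuous.aestronglyMeasurable (by fun_prop))]
  rw [integral_congr_ae ((ae_nonneg_fst_gamma_prod hm).mono fun p hp =>
    norm_specularSignal_sq V₁ V₂ hp)]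
  rw [integral_prod_mul (fun t : ℝ => t) (fun q : ℝ × ℝ =>
    V₁ ^ 2 + V₂ ^ 2 + 2 * V₁ * V₂ * Real.cos (q.1 - q.2)), integral_id_gammaMeasure hm hm,
    div_self hm.ne', one_mul,
    integral_comp_sub_uniformPhase_prod
      (k := fun x => V₁ ^ 2 + V₂ ^ 2 + 2 * V₁ * V₂ * Real.cos x) (by fun_prop)
      (fun x => by simp), integral_uniformPhase,
    intervalIntegral.integral_add (by simp) (Continuous.intervalIntegrable (by fun_prop) _ _),
    intervalIntegral.integral_const_mul, integral_cos]
  have := Real.pi_pos.ne'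
  simp
  field_simp

theorem integral_exp_neg_norm_sq_specularLaw {V₁ V₂ m s : ℝ} (hm : 0 < m) (hs : 0 ≤ s)
    (hV₁ : 0 ≤ V₁) (hV₂ : 0 ≤ V₂) :
    ∫ w, Real.exp (-(s * ‖w‖ ^ 2)) ∂specularLaw V₁ V₂ m
      = (2 * Real.pi)⁻¹ * ∫ x in (0 : ℝ)..2 * Real.pi,
        (1 + s * (V₁ ^ 2 + V₂ ^ 2 + 2 * V₁ * V₂ * Real.cos x) / m) ^ (-m) := by
  have := isProbabilityMeasure_gammaMeasure hm hm
  -- The expression equals `(V₁ - V₂)² + 2 V₁ V₂ (1 + cos x)`.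
  have hnn : ∀ x, 0 ≤ V₁ ^ 2 + V₂ ^ 2 + 2 * V₁ * V₂ * Real.cos x := fun x => by
    nlinarith [mul_nonneg (mul_nonneg hV₁ hV₂) (by linarith [Real.neg_one_le_cos x] :
      0 ≤ 1 + Real.cos x), sq_nonneg (V₁ - V₂)]
  rw [specularLaw, integral_map (continuous_specularSignal V₁ V₂).aemeasurable
    (Continuous.aestronglyMeasurable (by fun_prop))]
  have hcongr : (fun p => Real.exp (-(s * ‖specularSignal V₁ V₂ p‖ ^ 2)))
      =ᵐ[(gammaMeasure m m).prod (uniformPhase.prod uniformPhase)] fun p => Real.exp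
        (-(s * (V₁ ^ 2 + V₂ ^ 2 + 2 * V₁ * V₂ * Real.cos (p.2.1 - p.2.2)) * p.1)) := by
    filter_upwards [ae_nonneg_fst_gamma_prod hm] with p hp
    rw [norm_specularSignal_sq V₁ V₂ hp]
    ring_nf
  have hint : Integrable (fun p : ℝ × ℝ × ℝ => Real.exp
      (-(s * (V₁ ^ 2 + V₂ ^ 2 + 2 * V₁ * V₂ * Real.cos (p.2.1 - p.2.2)) * p.1)))
      ((gammaMeasure m m).prod (uniformPhase.prod uniformPhase)) := by
    refine .of_bound (Continuous.aestronglyMeasurable (by fun_prop)) 1 ?_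
    filter_upwards [ae_nonneg_fst_gamma_prod hm] with p hp
    rw [Real.norm_eq_abs, Real.abs_exp]
    exact Real.exp_le_one_iff.2 (neg_nonpos.2 (mul_nonneg (mul_nonneg hs (hnn _)) hp))
  rw [integral_congr_ae hcongr, integral_prod_symm _ hint]
  simp only [integral_exp_neg_gammaMeasure hm hm (mul_nonneg hs (hnn _))]
  rw [integral_comp_sub_uniformPhase_prod (k := fun x =>
    (1 + s * (V₁ ^ 2 + V₂ ^ 2 + 2 * V₁ * V₂ * Real.cos x) / m) ^ (-m)), integral_uniformPhase]
  · refine Continuous.rpow_const (by fun_prop) fun x => Or.inl ?_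
    have := hnn x
    positivity
  · intro x
    simp

/-! ### The diffuse component: small discs under a complex Gaussian. -/

theorem measureReal_prod_eq_integral {α β : Type*} [MeasurableSpace α] [MeasurableSpace β]
    {μ : Measure α} {ν : Measure β} [IsFiniteMeasure μ] [IsFiniteMeasure ν] {s : Set (α × β)}
    (hs : MeasurableSet s) :
    (μ.prod ν).real s = ∫ x, ν.real (Prod.mk x ⁻¹' s) ∂μ := by
  simp only [measureReal_def]
  rw [integral_toReal (measurable_measure_prodMk_left hs).aemeasurable
    (ae_of_all _ fun _ => measure_lt_top _ _), Measure.prod_apply hs]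

/-- The circularly symmetric complex Gaussian law with variance `σ ^ 2` per component. -/
noncomputable def complexGaussian (σ : ℝ) : Measure ℂ :=
  ((gaussianReal 0 (Real.toNNReal (σ ^ 2))).prod
    (gaussianReal 0 (Real.toNNReal (σ ^ 2)))).map Complex.measurableEquivRealProd.symm

instance isProbabilityMeasure_complexGaussian (σ : ℝ) :
    IsProbabilityMeasure (complexGaussian σ) :=
  Measure.isProbabilityMeasure_map (MeasurableEquiv.measurable _).aemeasurable

/-- The density of the circularly symmetric complex Gaussian law. -/
noncomputable def complexGaussianPDFReal (σ : ℝ) (z : ℂ) : ℝ :=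
  (2 * Real.pi * σ ^ 2)⁻¹ * Real.exp (-(‖z‖ ^ 2 / (2 * σ ^ 2)))

theorem continuous_complexGaussianPDFReal (σ : ℝ) : Continuous (complexGaussianPDFReal σ) := by
  unfold complexGaussianPDFReal
  fun_prop

theorem complexGaussianPDFReal_nonneg (σ : ℝ) (z : ℂ) : 0 ≤ complexGaussianPDFReal σ z := by
  unfold complexGaussianPDFReal
  positivity

theorem complexGaussianPDFReal_le (σ : ℝ) (z : ℂ) :
    complexGaussianPDFReal σ z ≤ (2 * Real.pi * σ ^ 2)⁻¹ :=
  mul_le_of_le_one_right (by positivity)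
    (Real.exp_le_one_iff.2 (neg_nonpos.2 (by positivity)))

theorem gaussianPDF_mul_gaussianPDF_re_im (σ : ℝ) (z : ℂ) :
    gaussianPDF 0 (Real.toNNReal (σ ^ 2)) z.re * gaussianPDF 0 (Real.toNNReal (σ ^ 2)) z.im
      = ENNReal.ofReal (complexGaussianPDFReal σ z) := by
  rw [gaussianPDF, gaussianPDF, ← ENNReal.ofReal_mul (gaussianPDFReal_nonneg _ _ _)]
  congr 1
  have h : (0 : ℝ) ≤ 2 * Real.pi * σ ^ 2 := by positivity
  rw [gaussianPDFReal, gaussianPDFReal, Real.coe_toNNReal _ (sq_nonneg σ),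
    complexGaussianPDFReal, mul_mul_mul_comm, ← Real.exp_add, ← mul_inv, Real.mul_self_sqrt h,
    ← Complex.normSq_eq_norm_sq, Complex.normSq_apply]
  ring_nf

theorem complexGaussian_eq_withDensity {σ : ℝ} (hσ : 0 < σ) :
    complexGaussian σ
      = volume.withDensity fun z => ENNReal.ofReal (complexGaussianPDFReal σ z) := by
  have hv : Real.toNNReal (σ ^ 2) ≠ 0 := by
    rw [ne_eq, Real.toNNReal_eq_zero, not_le]
    positivity
  have hmg := measurable_gaussianPDF 0 (Real.toNNReal (σ ^ 2))
  have hmd : Measurable fun z => ENNReal.ofReal (complexGaussianPDFReal σ z) :=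
    (continuous_complexGaussianPDFReal σ).measurable.ennreal_ofReal
  have hvol := Complex.volume_preserving_equiv_real_prod.symm
  refine Measure.ext_of_lintegral _ fun f hf => ?_
  rw [complexGaussian, gaussianReal_of_var_ne_zero _ hv, prod_withDensity hmg hmg,
    lintegral_map hf (MeasurableEquiv.measurable _),
    lintegral_withDensity_eq_lintegral_mul _ (by fun_prop)
      (g := fun p => f (Complex.measurableEquivRealProd.symm p))
      (hf.comp (MeasurableEquiv.measurable _)),
    lintegral_withDensity_eq_lintegral_mul _ hmd hf, ← hvol.lintegral_comp (hmd.mul hf)]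
  refine lintegral_congr fun p => ?_
  simp only [Pi.mul_apply]
  rw [← gaussianPDF_mul_gaussianPDF_re_im]
  rfl

theorem measureReal_complexGaussian {σ : ℝ} (hσ : 0 < σ) {s : Set ℂ} (hs : MeasurableSet s) :
    (complexGaussian σ).real s = ∫ z in s, complexGaussianPDFReal σ z := by
  rw [measureReal_def, complexGaussian_eq_withDensity hσ, withDensity_apply _ hs,
    integral_eq_lintegral_of_nonneg_ae (ae_of_all _ (complexGaussianPDFReal_nonneg σ))
      (continuous_complexGaussianPDFReal σ).aestronglyMeasurable]

theorem volume_real_complex_ball_sqrt (z : ℂ) {v : ℝ} (hv : 0 ≤ v) :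
    (volume : Measure ℂ).real (Metric.ball z (Real.sqrt v)) = Real.pi * v := by
  rw [measureReal_def, Complex.volume_ball, ENNReal.toReal_mul, ENNReal.toReal_pow,
    ENNReal.toReal_ofReal (Real.sqrt_nonneg v), Real.sq_sqrt hv, mul_comm]
  simp

/-- Maximal density times area. The bound is uniform in the centre, as needed to dominate when the
centre is averaged. -/
theorem measureReal_complexGaussian_ball_le {σ : ℝ} (hσ : 0 < σ) (z : ℂ) {v : ℝ} (hv : 0 ≤ v) :
    (complexGaussian σ).real (Metric.ball z (Real.sqrt v)) ≤ (2 * σ ^ 2)⁻¹ * v := by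
  rw [measureReal_complexGaussian hσ Metric.isOpen_ball.measurableSet]
  have hfin : volume (Metric.ball z (Real.sqrt v)) < ⊤ := Metric.isBounded_ball.measure_lt_top
  have h := norm_setIntegral_le_of_norm_le_const (f := complexGaussianPDFReal σ) hfin
    (fun w _ => (Real.norm_of_nonneg (complexGaussianPDFReal_nonneg σ w)).trans_le
      (complexGaussianPDFReal_le σ w))
  refine (le_abs_self _).trans (h.trans_eq ?_)
  rw [volume_real_complex_ball_sqrt z hv]
  have := Real.pi_pos.ne'
  field_simp

/-- The density is continuous and the discs, of area `π v`, shrink to `z`, so the quotient tends to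
`π` times the density at `z`. -/
theorem tendsto_measureReal_complexGaussian_ball_div {σ : ℝ} (hσ : 0 < σ) (z : ℂ) :
    Tendsto (fun v => (complexGaussian σ).real (Metric.ball z (Real.sqrt v)) / v)
      (nhdsWithin 0 (Set.Ioi 0))
      (nhds ((2 * σ ^ 2)⁻¹ * Real.exp (-((2 * σ ^ 2)⁻¹ * ‖z‖ ^ 2)))) := by
  have hsqrt : Tendsto Real.sqrt (nhdsWithin 0 (Set.Ioi 0)) (nhds 0) := by
    have := Real.continuous_sqrt.tendsto 0
    rw [Real.sqrt_zero] at this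
    exact this.mono_left nhdsWithin_le_nhds
  have hsets : Tendsto (fun v => Metric.ball z (Real.sqrt v)) (nhdsWithin 0 (Set.Ioi 0))
      (nhds z).smallSets := by
    rw [tendsto_smallSets_iff]
    intro t ht
    obtain ⟨ε, hε, hball⟩ := Metric.mem_nhds_iff.1 ht
    filter_upwards [hsqrt.eventually (gt_mem_nhds hε)] with v hv
    exact (Metric.ball_subset_ball hv.le).trans hball
  have h := (continuous_complexGaussianPDFReal σ).continuousAt.integral_sub_linear_isLittleO_ae
    (μ := volume) (x := z)
    (continuous_complexGaussianPDFReal σ).stronglyMeasurable.stronglyMeasurableAtFilter hsets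
    (fun v => Real.pi * v) (by
      filter_upwards [self_mem_nhdsWithin] with v hv
      exact volume_real_complex_ball_sqrt z (le_of_lt hv))
  have h2 := (h.tendsto_div_nhds_zero.add_const (complexGaussianPDFReal σ z)).const_mul Real.pi
  rw [zero_add] at h2
  have hlim : Real.pi * complexGaussianPDFReal σ z
      = (2 * σ ^ 2)⁻¹ * Real.exp (-((2 * σ ^ 2)⁻¹ * ‖z‖ ^ 2)) := by
    have := Real.pi_pos.ne'
    rw [complexGaussianPDFReal, inv_mul_eq_div (2 * σ ^ 2)]
    field_simp
  rw [hlim] at h2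
  refine h2.congr' ?_
  filter_upwards [self_mem_nhdsWithin] with v hv
  have hv : v ≠ 0 := ne_of_gt hv
  have := Real.pi_pos.ne'
  rw [measureReal_complexGaussian hσ Metric.isOpen_ball.measurableSet, smul_eq_mul]
  field_simp
  ring

theorem integral_re_complexGaussian (σ : ℝ) : ∫ z, z.re ∂complexGaussian σ = 0 := by
  rw [complexGaussian, integral_map_equiv]
  simp only [Complex.measurableEquivRealProd_symm_apply]
  rw [integral_fun_fst (f := fun x : ℝ => x), integral_id_gaussianReal, smul_zero]

theorem integral_im_complexGaussian (σ : ℝ) : ∫ z, z.im ∂complexGaussian σ = 0 := by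
  rw [complexGaussian, integral_map_equiv]
  simp only [Complex.measurableEquivRealProd_symm_apply]
  rw [integral_fun_snd (f := fun x : ℝ => x), integral_id_gaussianReal, smul_zero]

theorem integrable_sq_gaussianReal (v : NNReal) : Integrable (fun x => x ^ 2) (gaussianReal 0 v) :=
  (memLp_id_gaussianReal (μ := 0) (v := v) 2).integrable_sq

theorem integral_sq_gaussianReal (v : NNReal) : ∫ x, x ^ 2 ∂gaussianReal 0 v = v := by
  have h := variance_of_integral_eq_zero (X := id) (μ := gaussianReal 0 v)
    measurable_id.aemeasurable (by simp)
  rw [variance_id_gaussianReal] at h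
  exact h.symm

theorem integrable_norm_sq_complexGaussian (σ : ℝ) :
    Integrable (fun z => ‖z‖ ^ 2) (complexGaussian σ) := by
  rw [complexGaussian, integrable_map_equiv]
  have h := integrable_sq_gaussianReal (Real.toNNReal (σ ^ 2))
  refine ((h.comp_fst _).add (h.comp_snd _)).congr (ae_of_all _ fun p => ?_)
  simp only [Function.comp_apply, Pi.add_apply, Complex.measurableEquivRealProd_symm_apply]
  rw [← Complex.normSq_eq_norm_sq, Complex.normSq_apply]
  ring

theorem integral_norm_sq_complexGaussian (σ : ℝ) :
    ∫ z, ‖z‖ ^ 2 ∂complexGaussian σ = 2 * σ ^ 2 := by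
  rw [complexGaussian, integral_map_equiv]
  have h := integrable_sq_gaussianReal (Real.toNNReal (σ ^ 2))
  have hsum : ∀ p : ℝ × ℝ, ‖Complex.measurableEquivRealProd.symm p‖ ^ 2 = p.1 ^ 2 + p.2 ^ 2 := by
    intro p
    rw [Complex.measurableEquivRealProd_symm_apply, ← Complex.normSq_eq_norm_sq,
      Complex.normSq_apply]
    ring
  simp only [hsum]
  rw [integral_add (h.comp_fst _) (h.comp_snd _), integral_fun_fst (f := fun x : ℝ => x ^ 2),
    integral_fun_snd (f := fun x : ℝ => x ^ 2), integral_sq_gaussianReal,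
    Real.coe_toNNReal _ (sq_nonneg σ)]
  simp
  ring

/-! ### Power of a random signal plus independent Gaussian noise. -/

theorem integral_norm_add_sq_prod_complexGaussian {S : Measure ℂ} [IsProbabilityMeasure S]
    {σ : ℝ} (hS : Integrable (fun w => ‖w‖ ^ 2) S) :
    ∫ p, ‖p.1 + p.2‖ ^ 2 ∂(S.prod (complexGaussian σ)) = ∫ w, ‖w‖ ^ 2 ∂S + 2 * σ ^ 2 := by
  have hN := integrable_norm_sq_complexGaussian σ
  have hmem : ∀ {μ : Measure ℂ}, Integrable (fun w => ‖w‖ ^ 2) μ → MemLp (fun w : ℂ => w) 2 μ :=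
    fun h => (memLp_two_iff_integrable_sq_norm continuous_id.aestronglyMeasurable).2 h
  have iS := (hmem hS).integrable one_le_two
  have iN := (hmem hN).integrable one_le_two
  have i1 : Integrable (fun p : ℂ × ℂ => 2 * (p.1.re * p.2.re)) (S.prod (complexGaussian σ)) :=
    (iS.re.mul_prod iN.re).const_mul 2
  have i2 : Integrable (fun p : ℂ × ℂ => 2 * (p.1.im * p.2.im)) (S.prod (complexGaussian σ)) :=
    (iS.im.mul_prod iN.im).const_mul 2
  -- The two cross terms integrate to zero by independence and centring of the noise.
  have hexp : ∀ p : ℂ × ℂ, ‖p.1 + p.2‖ ^ 2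
      = ((‖p.1‖ ^ 2 + ‖p.2‖ ^ 2) + 2 * (p.1.re * p.2.re)) + 2 * (p.1.im * p.2.im) := by
    intro p
    simp only [← Complex.normSq_eq_norm_sq, Complex.normSq_apply, Complex.add_re, Complex.add_im]
    ring
  simp only [hexp]
  have j : Integrable (fun p : ℂ × ℂ => ‖p.1‖ ^ 2 + ‖p.2‖ ^ 2) (S.prod (complexGaussian σ)) :=
    (hS.comp_fst (complexGaussian σ)).add (hN.comp_snd S)
  rw [integral_add (f := fun p : ℂ × ℂ => ‖p.1‖ ^ 2 + ‖p.2‖ ^ 2 + 2 * (p.1.re * p.2.re))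
      (j.add i1) i2, integral_add j i1,
    integral_add (hS.comp_fst _) (hN.comp_snd _), integral_const_mul, integral_const_mul,
    integral_prod_mul (fun z : ℂ => z.re) (fun z : ℂ => z.re),
    integral_prod_mul (fun z : ℂ => z.im) (fun z : ℂ => z.im),
    integral_re_complexGaussian, integral_im_complexGaussian,
    integral_fun_fst (f := fun w : ℂ => ‖w‖ ^ 2), integral_fun_snd (f := fun w : ℂ => ‖w‖ ^ 2),
    integral_norm_sq_complexGaussian]
  simp

theorem measureReal_map_norm_add_sq_Iio {S : Measure ℂ} [IsProbabilityMeasure S]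
    {σ : ℝ} (v : ℝ) :
    ((S.prod (complexGaussian σ)).map fun p => ‖p.1 + p.2‖ ^ 2).real (Set.Iio v)
      = ∫ w, (complexGaussian σ).real (Metric.ball (-w) (Real.sqrt v)) ∂S := by
  have hc : Measurable fun p : ℂ × ℂ => ‖p.1 + p.2‖ ^ 2 :=
    Continuous.measurable (by fun_prop)
  rw [map_measureReal_apply hc measurableSet_Iio,
    measureReal_prod_eq_integral (hc measurableSet_Iio)]
  refine integral_congr_ae (ae_of_all _ fun w => ?_)
  refine congrArg (complexGaussian σ).real (Set.ext fun z => ?_)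
  simp [Real.lt_sqrt, dist_eq_norm, add_comm]

theorem aestronglyMeasurable_measureReal_complexGaussian_ball (S : Measure ℂ) (σ v : ℝ) :
    AEStronglyMeasurable
      (fun w => (complexGaussian σ).real (Metric.ball (-w) (Real.sqrt v))) S := by
  have hset : MeasurableSet {p : ℂ × ℂ | dist p.2 (-p.1) < Real.sqrt v} :=
    (isOpen_lt (by fun_prop) (by fun_prop)).measurableSet
  exact (measurable_measure_prodMk_left (ν := complexGaussian σ)
    hset).ennreal_toReal.aestronglyMeasurable

theorem measureReal_map_norm_add_sq_Iio_le {S : Measure ℂ} [IsProbabilityMeasure S]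
    {σ : ℝ} (hσ : 0 < σ) {v : ℝ} (hv : 0 ≤ v) :
    ((S.prod (complexGaussian σ)).map fun p => ‖p.1 + p.2‖ ^ 2).real (Set.Iio v)
      ≤ (2 * σ ^ 2)⁻¹ * v := by
  rw [measureReal_map_norm_add_sq_Iio v]
  refine (integral_mono_of_nonneg (ae_of_all _ fun w => measureReal_nonneg)
    (integrable_const ((2 * σ ^ 2)⁻¹ * v)) (ae_of_all _ fun w =>
      measureReal_complexGaussian_ball_le hσ (-w) hv)).trans_eq ?_
  simp

theorem tendsto_measureReal_map_norm_add_sq_Iio_div {S : Measure ℂ} [IsProbabilityMeasure S]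
    {σ : ℝ} (hσ : 0 < σ) :
    Tendsto (fun v => ((S.prod (complexGaussian σ)).map fun p => ‖p.1 + p.2‖ ^ 2).real
        (Set.Iio v) / v) (nhdsWithin 0 (Set.Ioi 0))
      (nhds ((2 * σ ^ 2)⁻¹ * ∫ w, Real.exp (-((2 * σ ^ 2)⁻¹ * ‖w‖ ^ 2)) ∂S)) := by
  rw [← integral_const_mul]
  have h : Tendsto (fun v => ∫ w, (complexGaussian σ).real (Metric.ball (-w) (Real.sqrt v)) / v ∂S)
      (nhdsWithin 0 (Set.Ioi 0))
      (nhds (∫ w, (2 * σ ^ 2)⁻¹ * Real.exp (-((2 * σ ^ 2)⁻¹ * ‖w‖ ^ 2)) ∂S)) := by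
    refine tendsto_integral_filter_of_dominated_convergence (fun _ => (2 * σ ^ 2)⁻¹)
      (.of_forall fun v => ?_) ?_ (integrable_const _) (ae_of_all _ fun w => ?_)
    · simp only [div_eq_mul_inv]
      exact (aestronglyMeasurable_measureReal_complexGaussian_ball S σ v).mul_const _
    · filter_upwards [self_mem_nhdsWithin] with v hv
      refine ae_of_all _ fun w => ?_
      have hv : 0 < v := hv
      rw [Real.norm_of_nonneg (by positivity), div_le_iff₀ hv]
      exact measureReal_complexGaussian_ball_le hσ (-w) hv.le
    · simpa using tendsto_measureReal_complexGaussian_ball_div hσ (-w)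
  refine h.congr' ?_
  filter_upwards [self_mem_nhdsWithin] with v hv
  rw [measureReal_map_norm_add_sq_Iio v, integral_div]

/-- Reassociating the product law separates `(ζ, φ₁, φ₂)` from `(X, Y)`, so the signal-plus-noise
results apply. -/
theorem ftrPowerMeasure_eq_map (V₁ V₂ σ : ℝ) {m : ℝ} (hm : 0 < m) :
    ftrPowerMeasure V₁ V₂ σ m
      = ((specularLaw V₁ V₂ m).prod (complexGaussian σ)).map fun p => ‖p.1 + p.2‖ ^ 2 := by
  have := isProbabilityMeasure_gammaMeasure hm hm
  set N := (gaussianReal 0 (Real.toNNReal (σ ^ 2))).prod (gaussianReal 0 (Real.toNNReal (σ ^ 2)))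
    with hN
  have hassoc := (measurePreserving_prodAssoc uniformPhase uniformPhase N)
  have hmp := ((MeasurePreserving.id (gammaMeasure m m)).prod hassoc).comp
    (measurePreserving_prodAssoc (gammaMeasure m m) (uniformPhase.prod uniformPhase) N)
  have hsig : Continuous (fun p : ℝ × ℝ × ℝ × ℝ × ℝ =>
      ‖ftrSignal V₁ V₂ p.1 p.2.1 p.2.2.1 p.2.2.2.1 p.2.2.2.2‖ ^ 2) := by
    unfold ftrSignal
    fun_prop
  rw [ftrPowerMeasure, ← hN, ← hmp.map_eq, Measure.map_map hsig.measurable hmp.measurable,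
    specularLaw, complexGaussian, ← hN, Measure.map_prod_map _ _
      (continuous_specularSignal V₁ V₂).measurable (MeasurableEquiv.measurable _),
    Measure.map_map (Continuous.measurable (by fun_prop))
      ((continuous_specularSignal V₁ V₂).measurable.prodMap (MeasurableEquiv.measurable _))]
  congr 1
  funext p
  obtain ⟨⟨t, x, y⟩, a, b⟩ := p
  simp only [Function.comp_apply, Prod.map, MeasurableEquiv.prodAssoc, MeasurableEquiv.coe_mk,
    Equiv.prodAssoc_apply, id, ftrSignal, specularSignal,
    Complex.measurableEquivRealProd_symm_apply]
  congr 2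
  rw [add_assoc]
  congr 1
  apply Complex.ext <;> simp

/-! ### Shadowing, normalisation and the outage asymptotics. -/

/-- If `T` has a finite mean and is positive, and `V` is independent of `T` and has a bounded
difference quotient `P(V < v) / v` converging to `d` at `0`, then
`P(T⁻¹ V < x) / x` converges to `d * E[T]` as `x` tends to `0` from the right. -/
theorem tendsto_measureReal_prod_inv_mul_lt_div {μ ν : Measure ℝ} [IsProbabilityMeasure μ]
    [IsProbabilityMeasure ν] {C d : ℝ} (hpos : ∀ᵐ t ∂μ, 0 < t) (hint : Integrable (fun t => t) μ)
    (hC : ∀ v, 0 ≤ v → ν.real (Set.Iio v) ≤ C * v)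
    (hd : Tendsto (fun v => ν.real (Set.Iio v) / v) (nhdsWithin 0 (Set.Ioi 0)) (nhds d)) :
    Tendsto (fun x => (μ.prod ν).real {p | p.1⁻¹ * p.2 < x} / x) (nhdsWithin 0 (Set.Ioi 0))
      (nhds (d * ∫ t, t ∂μ)) := by
  rw [← integral_const_mul]
  have hset : ∀ x : ℝ, MeasurableSet {p : ℝ × ℝ | p.1⁻¹ * p.2 < x} := fun x =>
    measurableSet_lt (by fun_prop) measurable_const
  have hpre : ∀ x t : ℝ, 0 < t → Prod.mk t ⁻¹' {p : ℝ × ℝ | p.1⁻¹ * p.2 < x}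
      = Set.Iio (x * t) := by
    intro x t ht
    ext v
    simp only [Set.mem_preimage, Set.mem_ofPred_eq, Set.mem_Iio]
    rw [inv_mul_lt_iff₀ ht, mul_comm]
  have h : Tendsto
      (fun x => ∫ t, ν.real (Prod.mk t ⁻¹' {p : ℝ × ℝ | p.1⁻¹ * p.2 < x}) / x ∂μ)
      (nhdsWithin 0 (Set.Ioi 0)) (nhds (∫ t, d * t ∂μ)) := by
    -- The event has conditional probability at most `C * (x * t)`; after division by `x` the bound
    -- no longer depends on `x`.
    refine tendsto_integral_filter_of_dominated_convergence (fun t => C * t)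
      (.of_forall fun x => ?_) ?_ (hint.const_mul C) ?_
    · simp only [div_eq_mul_inv]
      exact ((measurable_measure_prodMk_left (ν := ν)
        (hset x)).ennreal_toReal.aestronglyMeasurable).mul_const _
    · filter_upwards [self_mem_nhdsWithin] with x hx
      have hx : 0 < x := hx
      filter_upwards [hpos] with t ht
      rw [hpre x t ht, Real.norm_of_nonneg (by positivity), div_le_iff₀ hx]
      exact (hC _ (by positivity)).trans_eq (by ring)
    · filter_upwards [hpos] with t ht
      have hmul : Tendsto (fun x => x * t) (nhdsWithin 0 (Set.Ioi 0))
          (nhdsWithin 0 (Set.Ioi 0)) := by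
        refine tendsto_nhdsWithin_iff.2 ⟨?_, ?_⟩
        · have : Tendsto (fun x : ℝ => x * t) (nhds 0) (nhds (0 * t)) :=
            (continuous_mul_const t).tendsto 0
          rw [zero_mul] at this
          exact this.mono_left nhdsWithin_le_nhds
        · filter_upwards [self_mem_nhdsWithin] with x hx
          exact mul_pos hx ht
      refine ((hd.comp hmul).mul_const t).congr' ?_
      filter_upwards [self_mem_nhdsWithin] with x hx
      have hx : x ≠ 0 := ne_of_gt hx
      rw [hpre x t ht, Function.comp_apply]
      field_simp
  refine h.congr fun x => ?_
  rw [measureReal_prod_eq_integral (hset x), integral_div]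

theorem integral_inverseGammaMeasure {lam β : ℝ} (hlam : 1 < lam) (hβ : 0 < β) :
    ∫ g, g ∂inverseGammaMeasure lam β = β / (lam - 1) := by
  have hlam1 : 0 < lam - 1 := by linarith
  rw [inverseGammaMeasure, integral_map (φ := fun t : ℝ => t⁻¹) (f := fun g => g)
    measurable_inv.aemeasurable aestronglyMeasurable_id, integral_gammaMeasure (by linarith) hβ]
  have h : ∀ t ∈ Set.Ioi (0 : ℝ),
      β ^ lam / Real.Gamma lam * t ^ (lam - 1) * Real.exp (-(β * t)) * t⁻¹
        = β ^ lam / Real.Gamma lam * (t ^ (lam - 1 - 1) * Real.exp (-(β * t))) := by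
    intro t ht
    rw [Real.rpow_sub_one (ne_of_gt ht) (lam - 1)]
    ring
  rw [setIntegral_congr_fun measurableSet_Ioi h, integral_const_mul,
    Real.integral_rpow_mul_exp_neg_mul_Ioi hlam1 hβ, one_div, Real.inv_rpow hβ.le,
    Real.rpow_sub_one hβ.ne']
  have hG : Real.Gamma lam = (lam - 1) * Real.Gamma (lam - 1) := by
    rw [← Real.Gamma_add_one hlam1.ne', sub_add_cancel]
  rw [hG]
  have := (Real.Gamma_pos_of_pos hlam1).ne'
  have := (Real.rpow_pos_of_pos hβ lam).ne'
  field_simp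

theorem integral_ftrPowerMeasure (V₁ V₂ σ : ℝ) {m : ℝ} (hm : 0 < m) :
    ∫ v, v ∂ftrPowerMeasure V₁ V₂ σ m = V₁ ^ 2 + V₂ ^ 2 + 2 * σ ^ 2 := by
  have := isProbabilityMeasure_specularLaw V₁ V₂ hm
  rw [ftrPowerMeasure_eq_map V₁ V₂ σ hm,
    integral_map (f := fun v => v) (Continuous.aemeasurable (by fun_prop))
      aestronglyMeasurable_id,
    integral_norm_add_sq_prod_complexGaussian (integrable_norm_sq_specularLaw V₁ V₂ hm),
    integral_norm_sq_specularLaw V₁ V₂ hm]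

theorem integral_exp_neg_specularLaw_eq_ordinaryHypergeometric {V₁ V₂ σ m K Δ : ℝ} (hm : 0 < m)
    (hσ : 0 < σ) (hV₁ : 0 ≤ V₁) (hV₂ : 0 ≤ V₂) (hK : 0 < K) (hΔ0 : 0 ≤ Δ) (hΔ1 : Δ ≤ 1)
    (hKV : K = (V₁ ^ 2 + V₂ ^ 2) / (2 * σ ^ 2))
    (hΔV : Δ = 2 * V₁ * V₂ / (V₁ ^ 2 + V₂ ^ 2)) :
    ∫ w, Real.exp (-((2 * σ ^ 2)⁻¹ * ‖w‖ ^ 2)) ∂specularLaw V₁ V₂ m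
      = ((1 + K / m) ^ m)⁻¹ *
        ordinaryHypergeometric (m / 2) ((1 + m) / 2) (1 : ℝ) (Δ ^ 2 / (m / K + 1) ^ 2) := by
  have hpi := Real.pi_pos
  have hS : V₁ ^ 2 + V₂ ^ 2 = K * (2 * σ ^ 2) := by rw [hKV]; field_simp
  have hprod : 2 * V₁ * V₂ = Δ * (K * (2 * σ ^ 2)) := by
    rw [← hS, hΔV]
    -- Positivity of `K` excludes a zero denominator in `Δ`.
    have : V₁ ^ 2 + V₂ ^ 2 ≠ 0 := by rw [hS]; positivity
    field_simp
  -- Chosen so that `1 + K/m + (K Δ / m) cos x = (1 + K/m) (1 + a cos x)`; it stays below `1` even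
  -- when `Δ = 1`.
  set a := Δ / (m / K + 1) with ha
  have ha0 : 0 ≤ a := by positivity
  have ha1 : a < 1 := by
    rw [ha, div_lt_one (by positivity)]
    have : 0 < m / K := by positivity
    linarith
  have hbase : ∀ x, (1 + (2 * σ ^ 2)⁻¹ * (V₁ ^ 2 + V₂ ^ 2 + 2 * V₁ * V₂ * Real.cos x) / m) ^ (-m)
      = ((1 + K / m) ^ m)⁻¹ * (1 + a * Real.cos x) ^ (-m) := by
    intro x
    have hnn : 0 ≤ 1 + a * Real.cos x := by
      nlinarith [Real.neg_one_le_cos x, Real.cos_le_one x]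
    rw [← Real.rpow_neg (by positivity), ← Real.mul_rpow (by positivity) hnn, hS, hprod, ha]
    congr 1
    field_simp
    ring
  rw [integral_exp_neg_norm_sq_specularLaw hm (by positivity) hV₁ hV₂]
  simp only [hbase]
  rw [intervalIntegral.integral_const_mul,
    integral_one_add_mul_cos_rpow (abs_lt.2 ⟨by linarith, ha1⟩), ha, div_pow]
  field_simp

theorem mainTheorem5 {Ω : Type*} [MeasurableSpace Ω] (P : Measure Ω) [IsProbabilityMeasure P]
    (lam m K Δ Zbar γth : ℝ)
    (hlam : 1 < lam) (hm : 0 < m) (hK : 0 < K) (hΔ0 : 0 ≤ Δ) (hΔ1 : Δ ≤ 1)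
    (hZbar : 0 < Zbar) (hγth : 0 < γth)
    (G V : Ω → ℝ)
    (hG : IsInverseGamma P G lam 1)
    (hV : IsFTR P V 1 m K Δ)
    (hGV : IndepFun G V P) :
    (fun γbar : ℝ =>
        outageProbability P (receivedSNR P (compositePower Zbar G V) γbar) γth)
      ~[atTop]
    (fun γbar : ℝ =>
        Real.Gamma (lam + 1) / (Real.Gamma lam * (lam - 1))
          * ((1 + K) / (1 + K / m) ^ m)
          * ordinaryHypergeometric (m / 2) ((1 + m) / 2) (1 : ℝ) (Δ ^ 2 / (m / K + 1) ^ 2)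
          * (γth / γbar)) := by
  obtain ⟨⟨β, hβ, hGlaw⟩, hGmean⟩ := hG
  obtain ⟨⟨V₁, V₂, σ, hV₁, hV₂, hσ, hKV, hΔV, hVlaw⟩, hVmean⟩ := hV
  have hlam0 : 0 < lam := by linarith
  have hlam1 : 0 < lam - 1 := by linarith
  have hmean : ∫ ω, compositePower Zbar G V ω ∂P = Zbar := by
    have h := hGV.integral_mul_eq_mul_integral hGlaw.aemeasurable.aestronglyMeasurable
      hVlaw.aemeasurable.aestronglyMeasurable
    simp only [Pi.mul_apply] at h
    simp only [compositePower, mul_assoc]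
    rw [integral_const_mul, h, hGmean, hVmean]
    ring
  have hβeq : β = lam - 1 := by
    rw [hGlaw.integral_eq, integral_inverseGammaMeasure hlam hβ, div_eq_one_iff_eq hlam1.ne']
      at hGmean
    exact hGmean
  -- The unit mean reads `2σ² (1 + K) = 1`.
  have hσK : (2 * σ ^ 2)⁻¹ = 1 + K := by
    rw [hVlaw.integral_eq, integral_ftrPowerMeasure V₁ V₂ σ hm] at hVmean
    rw [hKV]
    field_simp
    linarith
  have := isProbabilityMeasure_gammaMeasure hlam0 hβ
  have := isProbabilityMeasure_specularLaw V₁ V₂ hm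
  have hsq : Measurable fun p : ℂ × ℂ => ‖p.1 + p.2‖ ^ 2 := Continuous.measurable (by fun_prop)
  rw [ftrPowerMeasure_eq_map V₁ V₂ σ hm] at hVlaw
  set ν := ((specularLaw V₁ V₂ m).prod (complexGaussian σ)).map fun p => ‖p.1 + p.2‖ ^ 2
  have : IsProbabilityMeasure ν := Measure.isProbabilityMeasure_map hsq.aemeasurable
  have hlaw : HasLaw (fun ω => (G ω, V ω)) ((inverseGammaMeasure lam β).prod ν) P :=
    hGV.hasLaw_prod hGlaw hVlaw
  have hout : ∀ γbar, 0 < γbar →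
      outageProbability P (receivedSNR P (compositePower Zbar G V) γbar) γth
        = ((gammaMeasure lam β).prod ν).real {p | p.1⁻¹ * p.2 < γth / γbar} := by
    intro γbar hγ
    have hset : MeasurableSet {p : ℝ × ℝ | p.1 * p.2 < γth / γbar} :=
      measurableSet_lt (by fun_prop) measurable_const
    have hmap : (inverseGammaMeasure lam β).prod ν
        = ((gammaMeasure lam β).prod ν).map (Prod.map (fun t => t⁻¹) id) := by
      rw [inverseGammaMeasure, ← Measure.map_prod_map _ _ measurable_inv measurable_id,
        Measure.map_id]
    have hP := hlaw.measureReal_eq hset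
    rw [hmap, map_measureReal_apply (measurable_inv.prodMap measurable_id) hset] at hP
    refine Eq.trans ?_ hP
    simp only [outageProbability, receivedSNR, hmean]
    congr 1
    ext ω
    simp only [compositePower, Set.mem_ofPred_eq, lt_div_iff₀ hγ]
    rw [show γbar * (Zbar * G ω * V ω) / Zbar = G ω * V ω * γbar by field_simp]
  set F := ordinaryHypergeometric (m / 2) ((1 + m) / 2) (1 : ℝ) (Δ ^ 2 / (m / K + 1) ^ 2) with hF
  have hexp := integral_exp_neg_specularLaw_eq_ordinaryHypergeometric hm hσ hV₁ hV₂ hK hΔ0 hΔ1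
    hKV hΔV
  rw [← hF] at hexp
  -- Positivity is read off the integral of an exponential, avoiding the series; it makes the
  -- limiting constant nonzero.
  have hFpos : 0 < ((1 + K / m) ^ m)⁻¹ * F := by
    rw [← hexp]
    refine integral_exp_pos (.of_bound (Continuous.aestronglyMeasurable (by fun_prop)) 1
      (ae_of_all _ fun w => ?_))
    rw [Real.norm_eq_abs, Real.abs_exp]
    exact Real.exp_le_one_iff.2 (neg_nonpos.2 (by positivity))
  have hlim := tendsto_measureReal_prod_inv_mul_lt_div (ae_pos_gammaMeasure lam β)
    (integrable_id_gammaMeasure hlam0 hβ)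
    (fun v hv => measureReal_map_norm_add_sq_Iio_le (S := specularLaw V₁ V₂ m) hσ hv)
    (tendsto_measureReal_map_norm_add_sq_Iio_div hσ)
  rw [integral_id_gammaMeasure hlam0 hβ, hexp, hσK, hβeq] at hlim
  have hx : Tendsto (fun γbar : ℝ => γth / γbar) atTop (nhdsWithin 0 (Set.Ioi 0)) := by
    refine tendsto_nhdsWithin_iff.2 ⟨tendsto_const_nhds.div_atTop tendsto_id, ?_⟩
    filter_upwards [eventually_gt_atTop 0] with γbar hγ
    exact div_pos hγth hγ
  set c := (1 + K) * (((1 + K / m) ^ m)⁻¹ * F) * (lam / (lam - 1)) with hc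
  have hcpos : 0 < c := by positivity
  have hcoef : Real.Gamma (lam + 1) / (Real.Gamma lam * (lam - 1))
      * ((1 + K) / (1 + K / m) ^ m) * F = c := by
    rw [hc, Real.Gamma_add_one hlam0.ne']
    have := (Real.Gamma_pos_of_pos hlam0).ne'
    field_simp
  simp only [hcoef]
  rw [isEquivalent_iff_tendsto_one]
  · have h1 := (hlim.comp hx).div_const c
    rw [div_self hcpos.ne'] at h1
    refine h1.congr' ?_
    filter_upwards [eventually_gt_atTop 0] with γbar hγ
    rw [Pi.div_apply, hout γbar hγ, Function.comp_apply, div_div, mul_comm c, hβeq]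
  · filter_upwards [eventually_gt_atTop 0] with γbar hγ
    positivity
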